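/- \textbf{Definitions.} Let $\mathcal{Y},\mathcal{Z}$ be finite sets. A \emph{pricing DC cone} over $\mathcal{Y}$ is a set $A\subseteq\mathbb{R}^{\mathcal{Y}}$ with $\gamma A\subseteq A$ for all $\gamma\ge 0$ and such that $a\in A$, $a'\le a$ pointwise imply $a'\in A$; write $A\in\mathrm{DCCone}(\mathcal{Y})$. (It may be empty and need not be convex.) Let $\Delta_{\mathcal{Y}}$ be the set of probability vectors on $\mathcal{Y}$, $\langle p,a\rangle=\sum_y p(y)a(y)$, and for $p\in\Delta_{\mathcal{Y}}$ let $p^{\circ}=\{a\in\mathbb{R}^{\mathcal{Y}}:\langle p,a\rangle\le 0\}$. Let $\mathrm{hull}(A)$ denote the convex hull; $A$ is \emph{informative} if $\mathrm{hull}(A)=\mathbb{R}^{\mathcal{Y}}$. For $A\in\mathrm{DCCone}(\mathcal{Y})$, $B\in\mathrm{DCCone}(\mathcal{Z})$ and $F:\mathcal{Y}\to\mathrm{DCCone}(\mathcal{Z})$ define $$A\otimes B=\{(y,z)\mapsto a(y)+b(z)+c(y,z):a\in A,\ b\in B,\ c\in\mathbb{R}_{\le 0}^{\mathcal{Y}\times\mathcal{Z}}\},$$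 $$A\ltimes F=\{(y,z)\mapsto a(y)+f(y,z):a\in A,\ f(y,\cdot)\in F(y)\ \text{for all } y\},\qquad A\ltimes B=A\ltimes(y\mapsto B),$$ $$F\#A=\{b\in\mathbb{R}^{\mathcal{Z}}:((y,z)\mapsto b(z))\in A\ltimes F\}.$$ $B$ is \emph{nondeterministically degraded} with respect to $A$, written $B\preceq A$, if $B\subseteq F\#A$ for some $F:\mathcal{Y}\to\mathrm{DCCone}(\mathcal{Z})$ such that $F(y)$ is non-informative for every $y$. The \emph{information capacity} of $A$ is the extended real $$\mathrm{I}(A)=\inf_{q\in\Delta_{\mathcal{Y}}}\ \sup_{a\in A}\ \inf_{p\in\Delta_{\mathcal{Y}}:\,\langle p,a\rangle\le 0}D(p\Vert q),\qquad D(p\Vert q)=\sum_{y:\,p(y)>0}p(y)\log_2\frac{p(y)}{q(y)},$$ where $D(p\Vert q)=\infty$ if $\mathrm{supp}(p)\not\subseteq\mathrm{supp}(q)$, an infimum over the empty set is $\infty$ (so $\mathrm{I}(\mathbb{R}^{\mathcal{Y}})=\infty$), and $\mathrm{I}(\emptyset)=-\infty$. For a finitely supported distribution $p_T$ on a set and a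 conditional distribution $p_{Y|T}$ from that set to $\mathcal{Y}$, $I(T;Y)$ is the mutual information in bits of $(T,Y)\sim p_Tp_{Y|T}$. \textbf{Proposition.} Let $\mathcal{Y},\mathcal{Z}$ be finite, and let $A\in\mathrm{DCCone}(\mathcal{Y})$, $B\in\mathrm{DCCone}(\mathcal{Z})$ be nonempty. \begin{enumerate} \item $\mathrm{I}(A)=0$ if and only if $\mathrm{hull}(A)\neq\mathbb{R}^{\mathcal{Y}}$, i.e., $A$ is non-informative. \item (Monotonicity) If $B\preceq A$, then $\mathrm{I}(B)\le\mathrm{I}(A)$. \item (Additivity) $\mathrm{I}(A\otimes B)=\mathrm{I}(A\ltimes B)=\mathrm{I}(A)+\mathrm{I}(B)$. \item (Alternative characterization) $\mathrm{I}(A)=\sup_{p_T}\inf_{p_{Y|T}}I(T;Y)$, where the supremum is over finitely supported distributions $p_T$ on $A$, and the infimum is over conditional distributions $p_{Y|T}$ from $A$ to $\mathcal{Y}$ with $\langle p_{Y|T}(\cdot|t),t\rangle\le 0$ for every $t\in A$ (and is $\infty$ if there is no such $p_{Y|T}$). \item (Shannon capacity) If $A=\bigcup_{x\in\mathcal{X}}(p_{Y|X}(\cdot|x))^{\circ}$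 for a conditional distribution $p_{Y|X}$ from a finite set $\mathcal{X}$ to $\mathcal{Y}$, then $\mathrm{I}(A)=\max_{p_X}I(X;Y)$, the maximum being over distributions $p_X$ on $\mathcal{X}$ and attained. \end{enumerate} -/

import Mathlib

universe u v w

noncomputable section

/-- A pricing downward closed cone (pricing DC cone) over `Y`: a set of functions `Y → ℝ`
closed under scaling by nonnegative reals and under pointwise decrease. It may be empty and it
need not be convex. -/
structure DCCone (Y : Type u) where
  /-- The set of portfolios. -/
  carrier : Set (Y → ℝ)
  smul_mem : ∀ (c : ℝ) (a : Y → ℝ), 0 ≤ c → a ∈ carrier → c • a ∈ carrier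
  isLowerSet : IsLowerSet carrier

namespace DCCone

instance instSetLike (Y : Type u) : SetLike (DCCone Y) (Y → ℝ) where
  coe := DCCone.carrier
  coe_injective A B h := by
    cases A
    cases B
    congr

/-- The halfspace DC cone `p° = {a | ⟨p, a⟩ ≤ 0}` of a probability vector `p`. -/
def halfspace {Y : Type u} [Fintype Y] (p : stdSimplex ℝ Y) : DCCone Y where
  carrier := {a | ∑ y, (p : Y → ℝ) y * a y ≤ 0}
  smul_mem c a hc ha := by
    have h : ∑ y, (p : Y → ℝ) y * (c • a) y = c * ∑ y, (p : Y → ℝ) y * a y := by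
      rw [Finset.mul_sum]
      refine Finset.sum_congr rfl fun y _ => ?_
      simp only [Pi.smul_apply, smul_eq_mul]
      ring
    simp only [Set.mem_ofPred_eq] at ha ⊢
    rw [h]
    exact mul_nonpos_of_nonneg_of_nonpos hc ha
  isLowerSet a b hba ha :=
    (Finset.sum_le_sum fun y _ => mul_le_mul_of_nonneg_left (hba y) (p.2.1 y)).trans ha

/-- The union of a family of DC cones. -/
def iUnion {Y : Type u} {ι : Type v} (A : ι → DCCone Y) : DCCone Y where
  carrier := ⋃ i, (A i : Set (Y → ℝ))
  smul_mem c a hc ha := by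
    obtain ⟨i, hi⟩ := Set.mem_iUnion.1 ha
    exact Set.mem_iUnion.2 ⟨i, (A i).smul_mem c a hc hi⟩
  isLowerSet := isLowerSet_iUnion fun i => (A i).isLowerSet

/-- The product `A ⊗ B`: all functions `(y, z) ↦ a y + b z + c (y, z)` with `a ∈ A`, `b ∈ B`
and `c ≤ 0`. -/
def prod {Y : Type u} {Z : Type v} (A : DCCone Y) (B : DCCone Z) : DCCone (Y × Z) where
  carrier := {s | ∃ a ∈ A, ∃ b ∈ B, ∃ c : Y × Z → ℝ, c ≤ 0 ∧
    s = fun yz => a yz.1 + b yz.2 + c yz}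
  smul_mem γ s hγ hs := by
    obtain ⟨a, ha, b, hb, c, hc, rfl⟩ := hs
    refine ⟨γ • a, A.smul_mem γ a hγ ha, γ • b, B.smul_mem γ b hγ hb, γ • c, fun yz => ?_, ?_⟩
    · exact mul_nonpos_of_nonneg_of_nonpos hγ (hc yz)
    · funext yz
      simp only [Pi.smul_apply, smul_eq_mul]
      ring
  isLowerSet s t hts hs := by
    obtain ⟨a, ha, b, hb, c, hc, rfl⟩ := hs
    refine ⟨a, ha, b, hb, fun yz => t yz - (a yz.1 + b yz.2), fun yz => ?_, ?_⟩
    · have h1 := hts yz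
      have h2 := hc yz
      simp only [Pi.zero_apply] at h1 h2 ⊢
      linarith
    · funext yz
      ring

/-- The semidirect product `A ⋉ F` of a DC cone `A` over `Y` and a map `F` from `Y` to the DC
cones over `Z`: all functions `(y, z) ↦ a y + f y z` with `a ∈ A` and `f y ∈ F y` for all `y`. -/
def semidirect {Y : Type u} {Z : Type v} (A : DCCone Y) (F : Y → DCCone Z) : DCCone (Y × Z) where
  carrier := {s | ∃ a ∈ A, ∃ f : Y → Z → ℝ, (∀ y, f y ∈ F y) ∧ s = fun yz => a yz.1 + f yz.1 yz.2}
  smul_mem γ s hγ hs := by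
    obtain ⟨a, ha, f, hf, rfl⟩ := hs
    refine ⟨γ • a, A.smul_mem γ a hγ ha, γ • f, fun y => (F y).smul_mem γ (f y) hγ (hf y), ?_⟩
    funext yz
    simp only [Pi.smul_apply, smul_eq_mul]
    ring
  isLowerSet s t hts hs := by
    obtain ⟨a, ha, f, hf, rfl⟩ := hs
    refine ⟨a, ha, fun y z => t (y, z) - a y, fun y => (F y).isLowerSet (fun z => ?_) (hf y), ?_⟩
    · have h := hts (y, z)
      simp only at h ⊢
      linarith
    · funext yz
      simp

/-- The semidirect product `A ⋉ B` of two DC cones: the semidirect product of `A` and the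
constant map with value `B`. -/
def semidirectConst {Y : Type u} {Z : Type v} (A : DCCone Y) (B : DCCone Z) : DCCone (Y × Z) :=
  A.semidirect fun _ => B

/-- The pushforward `f # A = {b | b ∘ f ∈ A}` by a function `f`. -/
def map {Y : Type u} {Z : Type v} (f : Y → Z) (A : DCCone Y) : DCCone Z where
  carrier := {b | (fun y => b (f y)) ∈ A}
  smul_mem γ _ hγ hb := A.smul_mem γ _ hγ hb
  isLowerSet _ _ hcb hb := A.isLowerSet (fun y => hcb (f y)) hb

/-- The pushforward `F # A = π₂ # (A ⋉ F)` by a map `F` from `Y` to the DC cones over `Z`. -/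
def bind {Y : Type u} {Z : Type v} (F : Y → DCCone Z) (A : DCCone Y) : DCCone Z :=
  map Prod.snd (A.semidirect F)

/-- `A` is informative if its convex hull is the whole space. -/
def Informative {Y : Type u} (A : DCCone Y) : Prop :=
  convexHull ℝ (A : Set (Y → ℝ)) = Set.univ

/-- `B ⪯ A`: `B` is nondeterministically degraded with respect to `A`, i.e. `B ⊆ F # A` for some
pointwise non-informative `F`. -/
def NondetDegraded {Y : Type u} {Z : Type v} (B : DCCone Z) (A : DCCone Y) : Prop :=
  ∃ F : Y → DCCone Z, (∀ y, ¬ (F y).Informative) ∧ (B : Set (Z → ℝ)) ⊆ bind F A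

end DCCone

open Classical in
/-- The Kullback-Leibler divergence, in bits, of probability vectors on a finite set: it is
`∑ y, p y * log₂ (p y / q y)` (terms with `p y = 0` vanish) if the support of `p` is contained in
that of `q`, and `⊤` otherwise. -/
def klDivergence {Y : Type u} [Fintype Y] (p q : stdSimplex ℝ Y) : EReal :=
  if ∀ y, (p : Y → ℝ) y ≠ 0 → (q : Y → ℝ) y ≠ 0 then
    ((∑ y, (p : Y → ℝ) y * Real.logb 2 ((p : Y → ℝ) y / (q : Y → ℝ) y) : ℝ) : EReal)
  else ⊤

open Classical in
/-- The information capacity `inf_q sup_{a ∈ A} inf_{p : ⟨p, a⟩ ≤ 0} D(p ‖ q)` of a DC cone over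
a finite set, an extended real. It is `⊥` for the empty cone by convention; that it is `⊤` for
the full cone follows from the formula, see `infoCapacity_eq_top`. -/
def infoCapacity {Y : Type u} [Fintype Y] (A : DCCone Y) : EReal :=
  if (A : Set (Y → ℝ)).Nonempty then
    ⨅ q : stdSimplex ℝ Y, ⨆ a ∈ A,
      ⨅ (p : stdSimplex ℝ Y) (_ : ∑ y, (p : Y → ℝ) y * a y ≤ 0), klDivergence p q
  else ⊥

theorem infoCapacity_eq_top {Y : Type u} [Fintype Y] (A : DCCone Y)
    (hA : (A : Set (Y → ℝ)) = Set.univ) : infoCapacity A = ⊤ := by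
  have hmem : ∀ a : Y → ℝ, a ∈ A := fun a => by
    have : a ∈ (A : Set (Y → ℝ)) := hA ▸ Set.mem_univ a
    exact this
  rw [infoCapacity, if_pos ⟨0, hmem 0⟩, iInf_eq_top]
  intro q
  refine top_le_iff.1 (le_iSup₂_of_le (fun _ => 1) (hmem _) ?_)
  refine le_iInf₂ fun p hp => ?_
  have h : ∑ y, (p : Y → ℝ) y = 1 := p.2.2
  simp only [mul_one, h] at hp
  linarith

/-- The mutual information `I(T; Y)`, in bits, where `T` has the finitely supported distribution
`p` on an arbitrary set, and `Y` has conditional distribution `W t` given `T = t`. -/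
def mutualInfo {T : Type u} {Y : Type v} [Fintype Y] (p : Convexity.StdSimplex ℝ T)
    (W : T → stdSimplex ℝ Y) : ℝ :=
  ∑ t ∈ p.weights.support, ∑ y, p.weights t * (W t : Y → ℝ) y *
    Real.logb 2 ((W t : Y → ℝ) y / ∑ s ∈ p.weights.support, p.weights s * (W s : Y → ℝ) y)

end

/-! Lagrange duality removes the inner infimum: the least divergence `D(p‖q)` in nats over `⟨p, a⟩ ≤
0` is the supremum over `l ≥ 0` of `-log E_q[exp (-l a)]`. As `A` is a cone, the multiplier `l` is
absorbed into `a`, so `2 ^ (-I(A)) = sup_q inf_{a ∈ A} E_q[exp (-a)]`. The two halves are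
`le_infoCapacity` and `infoCapacity_le`; the rest is a study of exponential moments.

A non-informative cone has a price vector under which all its portfolios have nonpositive mean,
hence moment at least 1; this gives half of the zero criterion, and monotonicity. Additivity holds
because `exp (-(a + b))` factors. For the mutual information formula,
`exists_mem_convexHull_forall_lt` acts as a minimax theorem: it yields one finite mixture of
portfolios that is good against every `q`, and the log-sum inequality turns it into a bound on
mutual information. For a union of halfspaces, choosing a halfspace for each portfolio turns that
mixture into a channel input. -/

section Auxiliary

open Real Finset

/-! ### Duality between relative entropy and exponential moments. -/

/-- Log-sum inequality, for a normalised first argument. -/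
theorem neg_log_sum_le {ι : Type*} (s : Finset ι) (p r : ι → ℝ) (hp : ∀ i ∈ s, 0 ≤ p i)
    (hr : ∀ i ∈ s, 0 ≤ r i) (hpr : ∀ i ∈ s, r i = 0 → p i = 0) (hp1 : ∑ i ∈ s, p i = 1) :
    -log (∑ i ∈ s, r i) ≤ ∑ i ∈ s, p i * log (p i / r i) := by
  have hR : 0 < ∑ i ∈ s, r i := by
    refine (sum_nonneg hr).lt_of_ne fun h => ?_
    have h0 := (sum_eq_zero_iff_of_nonneg hr).1 h.symm
    rw [sum_eq_zero fun i hi => hpr i hi (h0 i hi)] at hp1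
    exact zero_ne_one hp1
  set R := ∑ i ∈ s, r i with hRdef
  have key : ∀ i ∈ s, -(p i * log R) + p i - r i / R ≤ p i * log (p i / r i) := by
    intro i hi
    rcases (hp i hi).eq_or_lt with h | h
    · rw [← h]
      have := div_nonneg (hr i hi) hR.le
      simp only [zero_mul]
      linarith
    · have hri : 0 < r i := (hr i hi).lt_of_ne fun h' => h.ne' (hpr i hi h'.symm)
      have h1 := one_sub_inv_le_log_of_pos (div_pos (mul_pos h hR) hri)
      rw [log_div (mul_pos h hR).ne' hri.ne', log_mul h.ne' hR.ne'] at h1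
      rw [log_div h.ne' hri.ne']
      have h2 := mul_le_mul_of_nonneg_left h1 h.le
      have h3 : p i * (1 - (p i * R / r i)⁻¹) = p i - r i / R := by
        field_simp
      rw [h3] at h2
      linarith
  have h4 := sum_le_sum key
  rw [sum_sub_distrib, sum_add_distrib, sum_neg_distrib, ← sum_mul, hp1, ← sum_div, ← hRdef,
    div_self hR.ne'] at h4
  linarith

/-- The relative entropy of two vectors, in nats. -/
noncomputable def relEntropy {Y : Type u} [Fintype Y] (p q : Y → ℝ) : ℝ :=
  ∑ y, p y * log (p y / q y)

/-- The expectation of `exp (-a)` under `q`. -/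
noncomputable def expMoment {Y : Type u} [Fintype Y] (q a : Y → ℝ) : ℝ :=
  ∑ y, q y * exp (-a y)

theorem expMoment_pos {Y : Type u} [Fintype Y] (q : stdSimplex ℝ Y) (a : Y → ℝ) :
    0 < expMoment ⇑q a := by
  refine (sum_nonneg fun y _ => mul_nonneg (stdSimplex.zero_le q y) (exp_pos _).le).lt_of_ne fun h => ?_
  have h0 := (sum_eq_zero_iff_of_nonneg fun y _ => mul_nonneg (stdSimplex.zero_le q y) (exp_pos _).le).1 h.symm
  have h1 : ∑ y, (q : Y → ℝ) y = 1 := q.2.2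
  rw [sum_eq_zero fun y hy => (mul_eq_zero.1 (h0 y hy)).resolve_right (exp_pos _).ne'] at h1
  exact zero_ne_one h1

theorem one_sub_le_expMoment {Y : Type u} [Fintype Y] (q : stdSimplex ℝ Y) (a : Y → ℝ) :
    1 - ∑ y, (q : Y → ℝ) y * a y ≤ expMoment ⇑q a := by
  have h1 : ∑ y, (q : Y → ℝ) y = 1 := q.2.2
  rw [expMoment, ← h1, ← sum_sub_distrib]
  refine sum_le_sum fun y _ => ?_
  have h := mul_le_mul_of_nonneg_left (add_one_le_exp (-a y)) (stdSimplex.zero_le q y)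
  linarith

/-- Weak duality: the log-sum inequality for `p` against `q * exp (-a)`, whose relative entropy
exceeds that against `q` by `⟨p, a⟩ ≤ 0`. -/
theorem neg_log_expMoment_le_relEntropy {Y : Type u} [Fintype Y] (p q : stdSimplex ℝ Y)
    (a : Y → ℝ) (ha : ∑ y, (p : Y → ℝ) y * a y ≤ 0)
    (hpq : ∀ y, (p : Y → ℝ) y ≠ 0 → (q : Y → ℝ) y ≠ 0) :
    -log (expMoment ⇑q a) ≤ relEntropy ⇑p ⇑q := by
  have h := neg_log_sum_le univ (p : Y → ℝ) (fun y => (q : Y → ℝ) y * exp (-a y))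
    (fun y _ => stdSimplex.zero_le p y) (fun y _ => mul_nonneg (stdSimplex.zero_le q y) (exp_pos _).le)
    (fun y _ hy => by_contra fun hp => hpq y hp ((mul_eq_zero.1 hy).resolve_right (exp_pos _).ne'))
    p.2.2
  have h2 : ∑ y, (p : Y → ℝ) y * log ((p : Y → ℝ) y / ((q : Y → ℝ) y * exp (-a y))) =
      relEntropy ⇑p ⇑q + ∑ y, (p : Y → ℝ) y * a y := by
    rw [relEntropy, ← sum_add_distrib]
    refine sum_congr rfl fun y _ => ?_
    by_cases hp : (p : Y → ℝ) y = 0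
    · simp [hp]
    · rw [log_div hp (mul_ne_zero (hpq y hp) (exp_pos _).ne'), log_mul (hpq y hp) (exp_pos _).ne',
        log_exp, log_div hp (hpq y hp)]
      ring
  rw [h2] at h
  exact h.trans (by linarith)

theorem relEntropy_nonneg {Y : Type u} [Fintype Y] (p q : stdSimplex ℝ Y)
    (hpq : ∀ y, (p : Y → ℝ) y ≠ 0 → (q : Y → ℝ) y ≠ 0) : 0 ≤ relEntropy ⇑p ⇑q := by
  have h := neg_log_expMoment_le_relEntropy p q 0 (by simp) hpq
  have h1 : expMoment (q : Y → ℝ) 0 = 1 := by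
    simp [expMoment]
  rwa [h1, log_one, neg_zero] at h

/-- Normalising a nonnegative reweighting `q * g` of a vector `q`. -/
theorem exists_stdSimplex_reweight {Y : Type u} [Fintype Y] (q g : Y → ℝ)
    (hq : ∀ y, 0 ≤ q y) (hg : ∀ y, 0 ≤ g y) (hs : 0 < ∑ y, q y * g y) :
    ∃ p : stdSimplex ℝ Y, ∀ y, (p : Y → ℝ) y = q y * g y / ∑ y, q y * g y := by
  refine ⟨⟨fun y => q y * g y / ∑ y, q y * g y,
    fun y => div_nonneg (mul_nonneg (hq y) (hg y)) hs.le, ?_⟩, fun y => rfl⟩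
  rw [← sum_div, div_self hs.ne']

/-- The tilted mean is positive at `l = 0` and nonpositive for large `l`, where the point with `a <
0` dominates; the intermediate value theorem does the rest. -/
theorem exists_tilt_mean_eq_zero {Y : Type u} [Fintype Y] (q a : Y → ℝ) (hq : ∀ y, 0 ≤ q y)
    (hpos : 0 < ∑ y, q y * a y) (hneg : ∃ y, q y ≠ 0 ∧ a y < 0) :
    ∃ l : ℝ, 0 ≤ l ∧ ∑ y, q y * exp (-(l * a y)) * a y = 0 := by
  obtain ⟨z, hqz, haz⟩ := hneg
  have hqz' : 0 < q z := (hq z).lt_of_ne' hqz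
  set S := ∑ y, q y * |a y| with hS
  have hS0 : 0 ≤ S := sum_nonneg fun y _ => mul_nonneg (hq y) (abs_nonneg _)
  -- With this `L`, `exp x ≥ 1 + x` makes the term at `z` at most `-S`, while all terms are bounded
  -- by `q y * |a y|`, of total `S`.
  set L := S / (q z * a z ^ 2) with hL
  have hL0 : 0 ≤ L := div_nonneg hS0 (mul_nonneg (hq z) (sq_nonneg _))
  set m : ℝ → ℝ := fun l => ∑ y, q y * exp (-(l * a y)) * a y with hm
  have hcont : Continuous m := by fun_prop
  have hm0 : 0 ≤ m 0 := by simpa [hm] using hpos.le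
  have hmL : m L ≤ 0 := by
    classical
    have h1 : ∀ y, q y * exp (-(L * a y)) * a y ≤
        q y * |a y| + if y = z then -S else 0 := by
      intro y
      have hgen : q y * exp (-(L * a y)) * a y ≤ q y * |a y| := by
        rw [mul_assoc]
        refine mul_le_mul_of_nonneg_left ?_ (hq y)
        rcases le_total 0 (a y) with h | h
        · rw [abs_of_nonneg h]
          exact mul_le_of_le_one_left h (exp_le_one_iff.2 (neg_nonpos.2 (mul_nonneg hL0 h)))
        · exact (mul_nonpos_of_nonneg_of_nonpos (exp_pos _).le h).trans (abs_nonneg _)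
      split_ifs with hy
      · subst hy
        have h2 := add_one_le_exp (-(L * a y))
        have h3 : L * a y * (q y * a y) = S := by
          rw [hL]
          field_simp [haz.ne, hqz]
        have h4 : q y * exp (-(L * a y)) * a y ≤ -S := by
          have h5 : exp (-(L * a y)) * (q y * a y) ≤ (-(L * a y)) * (q y * a y) :=
            mul_le_mul_of_nonpos_right (by linarith) (mul_nonpos_of_nonneg_of_nonpos (hq y) haz.le)
          linarith
        have := mul_nonneg (hq y) (abs_nonneg (a y))
        linarith
      · linarith
    refine (sum_le_sum fun y _ => h1 y).trans ?_
    rw [sum_add_distrib, ← hS]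
    simp
  obtain ⟨l, hl, hl0⟩ := intermediate_value_Icc' hL0 hcont.continuousOn ⟨hmL, hm0⟩
  exact ⟨l, hl.1, hl0⟩

/-- Lagrange duality for the projection of `q` onto the halfspace `⟨p, a⟩ ≤ 0`. -/
theorem exists_relEntropy_le {Y : Type u} [Fintype Y] (q : stdSimplex ℝ Y) (a : Y → ℝ) (c : ℝ)
    (h : ∀ l : ℝ, 0 ≤ l → exp (-c) ≤ expMoment ⇑q (l • a)) :
    ∃ p : stdSimplex ℝ Y, ∑ y, (p : Y → ℝ) y * a y ≤ 0 ∧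
      (∀ y, (p : Y → ℝ) y ≠ 0 → (q : Y → ℝ) y ≠ 0) ∧ relEntropy ⇑p ⇑q ≤ c := by
  have hq := stdSimplex.zero_le q
  have hq1 : ∑ y, (q : Y → ℝ) y = 1 := q.2.2
  -- the relative entropy of a reweighting of `q`
  have hrel : ∀ (p : stdSimplex ℝ Y) (g : Y → ℝ) (s b : ℝ), 0 < s →
      (∀ y, (p : Y → ℝ) y = (q : Y → ℝ) y * g y / s) →
      (∀ y, (q : Y → ℝ) y * g y * log (g y) = -(b * ((q : Y → ℝ) y * g y * a y))) →
      relEntropy ⇑p ⇑q = -(b * ∑ y, (p : Y → ℝ) y * a y) - log s := by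
    intro p g s b hs hp hg
    have hp1 : ∑ y, (p : Y → ℝ) y = 1 := p.2.2
    calc relEntropy ⇑p ⇑q
        = ∑ y, (-(b * ((p : Y → ℝ) y * a y)) - (p : Y → ℝ) y * log s) := by
          refine sum_congr rfl fun y _ => ?_
          by_cases h0 : (p : Y → ℝ) y = 0
          · simp [h0]
          · have h1 := h0
            rw [hp y] at h1
            have hqy : (q : Y → ℝ) y ≠ 0 := fun h' => h1 (by simp [h'])
            have hgy : g y ≠ 0 := fun h' => h1 (by simp [h'])
            have h2 : (p : Y → ℝ) y / (q : Y → ℝ) y = g y / s := by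
              rw [hp y]; field_simp
            rw [h2, log_div hgy hs.ne', mul_sub, hp y]
            have h3 : (q : Y → ℝ) y * g y / s * log (g y) =
                (q : Y → ℝ) y * g y * log (g y) / s := by ring
            rw [h3, hg y]
            ring
      _ = _ := by
          rw [sum_sub_distrib, sum_neg_distrib, ← mul_sum, ← sum_mul, hp1, one_mul]
  have hc : ∀ s : ℝ, 0 < s → exp (-c) ≤ s → -log s ≤ c := by
    intro s hs h'
    have := (le_log_iff_exp_le hs).2 h'
    linarith
  -- The optimal `p` is `q` itself if feasible, else the exponential tilt of mean zero, else (`a ≥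
  -- 0` on the support of `q`) `q` conditioned on `a = 0`, the limit of the tilts as `l → ∞`.
  by_cases hmean : ∑ y, (q : Y → ℝ) y * a y ≤ 0
  · refine ⟨q, hmean, fun _ => id, ?_⟩
    have h1 := hrel q (fun _ => 1) 1 0 one_pos (by simp) (by simp)
    have h0 := h 0 le_rfl
    rw [h1]
    have := hc 1 one_pos (by simpa [expMoment, hq1] using h0)
    simp at this ⊢
    exact this
  push Not at hmean
  by_cases hneg : ∃ y, (q : Y → ℝ) y ≠ 0 ∧ a y < 0
  · obtain ⟨l, hl, hl0⟩ := exists_tilt_mean_eq_zero q a hq hmean hneg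
    have hs : 0 < ∑ y, (q : Y → ℝ) y * exp (-(l * a y)) := expMoment_pos q (l • a)
    obtain ⟨p, hp⟩ := exists_stdSimplex_reweight q (fun y => exp (-(l * a y))) hq
      (fun _ => (exp_pos _).le) hs
    have hp0 : ∑ y, (p : Y → ℝ) y * a y = 0 := by
      simp_rw [hp, div_mul_eq_mul_div]
      rw [← sum_div, hl0, zero_div]
    refine ⟨p, hp0.le, fun y hy h' => hy (by rw [hp, h']; simp), ?_⟩
    rw [hrel p _ _ l hs hp fun y => by rw [log_exp]; ring, hp0]
    have := hc _ hs (h l hl)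
    linarith
  · push Not at hneg
    have hlim : Filter.Tendsto (fun l : ℝ => expMoment ⇑q (l • a)) Filter.atTop
        (nhds (∑ y, (q : Y → ℝ) y * if a y ≤ 0 then 1 else 0)) := by
      refine tendsto_finsetSum _ fun y _ => ?_
      by_cases hqy : (q : Y → ℝ) y = 0
      · simp [hqy]
      have hay := hneg y hqy
      refine Filter.Tendsto.const_mul _ ?_
      split_ifs with h0
      · have : a y = 0 := le_antisymm h0 hay
        simp [this]
      · push Not at h0
        refine tendsto_exp_atBot.comp ?_
        simp only [Pi.smul_apply, smul_eq_mul]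
        exact Filter.tendsto_neg_atTop_atBot.comp (Filter.tendsto_id.atTop_mul_const h0)
    have hge : exp (-c) ≤ ∑ y, (q : Y → ℝ) y * if a y ≤ 0 then 1 else 0 :=
      ge_of_tendsto hlim ((Filter.eventually_ge_atTop 0).mono fun l hl => h l hl)
    have hs := (exp_pos _).trans_le hge
    obtain ⟨p, hp⟩ := exists_stdSimplex_reweight q (fun y => if a y ≤ 0 then 1 else 0) hq
      (fun y => by split_ifs <;> norm_num) hs
    have hp0 : ∑ y, (p : Y → ℝ) y * a y = 0 := by
      refine sum_eq_zero fun y _ => ?_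
      rw [hp]
      by_cases hqy : (q : Y → ℝ) y = 0
      · simp [hqy]
      split_ifs with h0
      · rw [le_antisymm h0 (hneg y hqy), mul_zero]
      · simp
    refine ⟨p, hp0.le, fun y hy h' => hy (by rw [hp, h']; simp), ?_⟩
    rw [hrel p _ _ 0 hs hp fun y => by split_ifs <;> simp]
    have := hc _ hs hge
    linarith

/-! ### A minimax statement by separation. -/

/-- Separation of a convex hull from an orthant, in the form of a minimax statement. -/
theorem exists_mem_convexHull_forall_lt {Y : Type u} [Fintype Y] {S : Set (Y → ℝ)}
    (hS : S.Nonempty) {c : ℝ}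
    (h : ∀ q : stdSimplex ℝ Y, ∃ u ∈ S, ∑ y, (q : Y → ℝ) y * u y < c) :
    ∃ u ∈ convexHull ℝ S, ∀ y, u y < c := by
  classical
  by_contra hcon
  push Not at hcon
  have hP : {u : Y → ℝ | ∀ y, u y < c} = Set.univ.pi fun _ => Set.Iio c := by
    ext u; simp
  have hPconv : Convex ℝ {u : Y → ℝ | ∀ y, u y < c} := by
    rw [hP]; exact convex_pi fun _ _ => convex_Iio c
  have hPopen : IsOpen {u : Y → ℝ | ∀ y, u y < c} := by
    rw [hP]; exact isOpen_set_pi Set.finite_univ fun _ _ => isOpen_Iio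
  obtain ⟨f, s, hfP, hfS⟩ := geometric_hahn_banach_open hPconv hPopen (convex_convexHull ℝ S)
    (Set.disjoint_left.2 fun u hu hu' => by
      obtain ⟨y, hy⟩ := hcon u hu'
      exact absurd (hu y) (not_lt.2 hy))
  have hf : ∀ u : Y → ℝ, f u = ∑ y, f (Pi.single y 1) * u y := by
    intro u
    conv_lhs => rw [pi_eq_sum_univ' u]
    rw [map_sum]
    refine sum_congr rfl fun y _ => ?_
    rw [map_smul, smul_eq_mul, mul_comm]
  set w : Y → ℝ := fun y => f (Pi.single y 1) with hw
  -- The orthant is unbounded in direction `-e_y` and `f` is bounded above on it, so no weight is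
  -- negative.
  have hw0 : ∀ y, 0 ≤ w y := by
    intro y
    by_contra hy
    push Not at hy
    set K := f (fun _ => c - 1) with hK
    set t := max 0 ((s - K) / (-w y)) with ht
    have h1 := hfP ((fun _ => c - 1) - t • Pi.single y 1) fun z => by
      have h2 : 0 ≤ t * (Pi.single y 1 : Y → ℝ) z :=
        mul_nonneg (le_max_left _ _) (by by_cases hz : z = y <;> simp [hz])
      simp only [Pi.sub_apply, Pi.smul_apply, smul_eq_mul]
      linarith
    rw [map_sub, map_smul, smul_eq_mul, ← hK] at h1
    have h3 : (s - K) / (-w y) ≤ t := le_max_right _ _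
    rw [div_le_iff₀ (by linarith)] at h3
    change K - t * w y < s at h1
    linarith
  have hconst : ∀ k : ℝ, f (fun _ => k) = (∑ y, w y) * k := by
    intro k
    rw [hf, sum_mul]
  have hwpos : 0 < ∑ y, w y := by
    refine (sum_nonneg fun y _ => hw0 y).lt_of_ne fun h0 => ?_
    have hz := (sum_eq_zero_iff_of_nonneg fun y _ => hw0 y).1 h0.symm
    obtain ⟨b, hb⟩ := hS
    have h1 := hfP (fun _ => c - 1) fun y => by linarith
    have h2 := hfS b (subset_convexHull ℝ S hb)
    rw [hconst, ← h0, zero_mul] at h1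
    have h3 : f b = 0 := by
      rw [hf]
      exact sum_eq_zero fun y hy => by
        have : f (Pi.single y 1) = 0 := hz y hy
        rw [this, zero_mul]
    linarith
  -- Approach the corner `(c, ..., c)` of the open orthant from inside; then `w` normalised to a
  -- probability vector contradicts `h`.
  have hcs : (∑ y, w y) * c ≤ s := by
    refine le_of_forall_pos_lt_add fun e he => ?_
    have h1 := hfP (fun _ => c - e / ∑ y, w y) fun y => by
      have := div_pos he hwpos
      linarith
    rw [hconst, mul_sub, mul_div_cancel₀ _ hwpos.ne'] at h1
    linarith
  obtain ⟨q, hq⟩ := exists_stdSimplex_reweight w (fun _ => 1) hw0 (fun _ => zero_le_one)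
    (by simpa using hwpos)
  obtain ⟨b, hb, hbc⟩ := h q
  have h1 := hfS b (subset_convexHull ℝ S hb)
  have h2 : ∑ y, (q : Y → ℝ) y * b y = f b / ∑ y, w y := by
    rw [hf, sum_div]
    exact sum_congr rfl fun y _ => by
      rw [hq]
      simp only [mul_one]
      rw [div_mul_eq_mul_div]
  rw [h2, div_lt_iff₀ hwpos] at hbc
  linarith

/-! ### Passage from bits to nats, and basic facts on cones. -/

theorem klDivergence_of_support {Y : Type u} [Fintype Y] {p q : stdSimplex ℝ Y}
    (h : ∀ y, (p : Y → ℝ) y ≠ 0 → (q : Y → ℝ) y ≠ 0) :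
    klDivergence p q = ((relEntropy ⇑p ⇑q / log 2 : ℝ) : EReal) := by
  rw [klDivergence, if_pos h, relEntropy, sum_div]
  simp only [logb, mul_div_assoc]

theorem le_klDivergence_iff {Y : Type u} [Fintype Y] {p q : stdSimplex ℝ Y} {c : ℝ} :
    (c : EReal) ≤ klDivergence p q ↔
      ((∀ y, (p : Y → ℝ) y ≠ 0 → (q : Y → ℝ) y ≠ 0) → c * log 2 ≤ relEntropy ⇑p ⇑q) := by
  by_cases h : ∀ y, (p : Y → ℝ) y ≠ 0 → (q : Y → ℝ) y ≠ 0
  · rw [klDivergence_of_support h, EReal.coe_le_coe_iff, le_div_iff₀ (log_pos one_lt_two)]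
    exact ⟨fun h' _ => h', fun h' => h' h⟩
  · rw [klDivergence, if_neg h]
    exact ⟨fun _ h' => absurd h' h, fun _ => le_top⟩

namespace DCCone

theorem smul_mem' {Y : Type u} {A : DCCone Y} {c : ℝ} {a : Y → ℝ} (hc : 0 ≤ c) (ha : a ∈ A) :
    c • a ∈ A :=
  A.smul_mem c a hc ha

theorem mem_of_le {Y : Type u} {A : DCCone Y} {a b : Y → ℝ} (hba : b ≤ a) (ha : a ∈ A) : b ∈ A :=
  A.isLowerSet hba ha

theorem zero_mem {Y : Type u} {A : DCCone Y} (hA : (A : Set (Y → ℝ)).Nonempty) : 0 ∈ A := by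
  obtain ⟨a, ha⟩ := hA
  simpa using smul_mem' le_rfl (show a ∈ A from ha)

theorem prod_nonempty {Y : Type u} {Z : Type v} {A : DCCone Y} {B : DCCone Z} (hA : (A : Set (Y → ℝ)).Nonempty)
    (hB : (B : Set (Z → ℝ)).Nonempty) : (A.prod B : Set (Y × Z → ℝ)).Nonempty := by
  obtain ⟨a, ha⟩ := hA
  obtain ⟨b, hb⟩ := hB
  exact ⟨_, a, ha, b, hb, 0, le_rfl, rfl⟩

theorem prod_le_semidirectConst {Y : Type u} {Z : Type v} {A : DCCone Y} {B : DCCone Z} (s : Y × Z → ℝ)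
    (hs : s ∈ A.prod B) : s ∈ A.semidirectConst B := by
  obtain ⟨a, ha, b, hb, c, hc, rfl⟩ := hs
  refine ⟨a, ha, fun y z => b z + c (y, z), fun y => mem_of_le (fun z => ?_) hb, ?_⟩
  · have := hc (y, z)
    simp only [Pi.zero_apply] at this
    linarith
  · funext yz
    simp only [Prod.mk.eta]
    ring

end DCCone

/-! ### Capacity through exponential moments, and the zero criterion. -/

section Capacity

variable {Y : Type u} [Fintype Y] {A : DCCone Y}

theorem infoCapacity_of_nonempty (hA : (A : Set (Y → ℝ)).Nonempty) :
    infoCapacity A = ⨅ q : stdSimplex ℝ Y, ⨆ a ∈ A,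
      ⨅ (p : stdSimplex ℝ Y) (_ : ∑ y, (p : Y → ℝ) y * a y ≤ 0), klDivergence p q :=
  if_pos hA

theorem le_infoCapacity (hA : (A : Set (Y → ℝ)).Nonempty) {c : ℝ}
    (h : ∀ q : stdSimplex ℝ Y, ∃ a ∈ A, expMoment ⇑q a ≤ exp (-(c * log 2))) :
    (c : EReal) ≤ infoCapacity A := by
  rw [infoCapacity_of_nonempty hA]
  refine le_iInf fun q => ?_
  obtain ⟨a, ha, hqa⟩ := h q
  refine le_iSup₂_of_le a ha (le_iInf₂ fun p hp => le_klDivergence_iff.2 fun hpq => ?_)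
  have h1 := neg_log_expMoment_le_relEntropy p q a hp hpq
  have h2 := (log_le_iff_le_exp (expMoment_pos q a)).2 hqa
  linarith

/-- Strong duality; the cone property supplies the hypothesis for all multiples `l • a` at once. -/
theorem infoCapacity_le (hA : (A : Set (Y → ℝ)).Nonempty) {c : ℝ}
    (h : ∃ q : stdSimplex ℝ Y, ∀ a ∈ A, exp (-(c * log 2)) ≤ expMoment ⇑q a) :
    infoCapacity A ≤ c := by
  rw [infoCapacity_of_nonempty hA]
  obtain ⟨q, hq⟩ := h
  refine iInf_le_of_le q (iSup₂_le fun a ha => ?_)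
  obtain ⟨p, hpa, hpq, hp⟩ := exists_relEntropy_le q a (c * log 2)
    fun l hl => hq (l • a) (DCCone.smul_mem' hl ha)
  refine iInf₂_le_of_le p hpa ?_
  rw [klDivergence_of_support hpq, EReal.coe_le_coe_iff]
  exact (div_le_iff₀ (log_pos one_lt_two)).2 hp

theorem exists_expMoment_lt (hA : (A : Set (Y → ℝ)).Nonempty) {c : ℝ}
    (hc : (c : EReal) < infoCapacity A) (q : stdSimplex ℝ Y) :
    ∃ a ∈ A, expMoment ⇑q a < exp (-(c * log 2)) := by
  by_contra! h
  exact hc.not_ge (infoCapacity_le hA ⟨q, h⟩)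

theorem exists_forall_lt_expMoment (hA : (A : Set (Y → ℝ)).Nonempty) {c : ℝ}
    (hc : infoCapacity A < c) :
    ∃ q : stdSimplex ℝ Y, ∀ a ∈ A, exp (-(c * log 2)) < expMoment ⇑q a := by
  by_contra! h
  exact hc.not_ge (le_infoCapacity hA h)

theorem infoCapacity_nonneg (hA : (A : Set (Y → ℝ)).Nonempty) : 0 ≤ infoCapacity A :=
  le_infoCapacity (c := 0) hA fun q => ⟨0, DCCone.zero_mem hA, by simp [expMoment]⟩

/-- Otherwise separation, applied to `-A`, puts a strictly positive vector in the hull of `A`;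
scaling it up and decreasing it reaches every vector. -/
theorem DCCone.exists_forall_mean_nonpos (hA : (A : Set (Y → ℝ)).Nonempty) (h : ¬ A.Informative) :
    ∃ q : stdSimplex ℝ Y, ∀ a ∈ A, ∑ y, (q : Y → ℝ) y * a y ≤ 0 := by
  by_contra! hcon
  apply h
  obtain ⟨u, hu, hu0⟩ := exists_mem_convexHull_forall_lt (S := -(A : Set (Y → ℝ))) (c := 0)
    hA.neg fun q => by
      obtain ⟨a, ha, hqa⟩ := hcon q
      exact ⟨-a, Set.neg_mem_neg.2 ha, by simpa using hqa⟩
  rw [convexHull_neg, Set.mem_neg] at hu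
  refine Set.eq_univ_of_forall fun x => ?_
  obtain ⟨ι, _, w, z, hw0, hw1, hz, hwz⟩ := mem_convexHull_iff_exists_fintype.1 hu
  set t := ∑ y, |x y / u y| with ht
  have ht0 : 0 ≤ t := sum_nonneg fun y _ => abs_nonneg _
  have hle : ∀ y, x y ≤ t * -u y := by
    intro y
    have h1 : |x y / u y| ≤ t :=
      single_le_sum (f := fun y => |x y / u y|) (fun y _ => abs_nonneg _) (mem_univ y)
    have h2 : -(x y / u y) ≤ t := (neg_le_abs _).trans h1
    have h3 := mul_le_mul_of_nonneg_right h2 (neg_nonneg.2 (hu0 y).le)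
    have h4 : -(x y / u y) * -u y = x y := by
      field_simp [(hu0 y).ne]
    linarith
  -- Lower every `t • z i` by the same nonnegative vector `t • -u - x`: each stays in the cone, and
  -- the combination becomes `x`.
  refine mem_convexHull_of_exists_fintype w (fun i => t • z i + (x - t • -u)) hw0 hw1
    (fun i => DCCone.mem_of_le (fun y => ?_) (DCCone.smul_mem' ht0 (hz i))) ?_
  · have := hle y
    simp only [Pi.add_apply, Pi.sub_apply, Pi.smul_apply, smul_eq_mul, Pi.neg_apply] at this ⊢
    linarith
  · simp_rw [smul_add, smul_comm _ t]
    rw [sum_add_distrib, ← smul_sum, hwz, ← sum_smul, hw1, one_smul]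
    abel

theorem infoCapacity_eq_zero_of_not_informative (hA : (A : Set (Y → ℝ)).Nonempty)
    (h : ¬ A.Informative) : infoCapacity A = 0 := by
  refine le_antisymm (infoCapacity_le (c := 0) hA ?_) (infoCapacity_nonneg hA)
  obtain ⟨q, hq⟩ := DCCone.exists_forall_mean_nonpos hA h
  refine ⟨q, fun a ha => ?_⟩
  have := one_sub_le_expMoment q a
  have := hq a ha
  simp only [zero_mul, neg_zero, exp_zero]
  linarith

theorem exp_neg_le_of_abs_le_one {x : ℝ} (hx : |x| ≤ 1) : exp (-x) ≤ 1 - x + x ^ 2 := by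
  have h := abs_exp_sub_one_sub_id_le (x := -x) (by rwa [abs_neg])
  have := (abs_le.1 h).2
  nlinarith

/-- Write the constant 1 as a convex combination of portfolios `z i` and scale by a small `e`. The
mixture of the `exp (-(e * z i y))` gains `e` to first order and loses at most `e ^ 2 * M ^ 2 = e /
2` to second order, uniformly in `y`. So under every `q` some `e • z i` has moment at most `1 - e /
2`. -/
theorem infoCapacity_pos_of_informative (hA : (A : Set (Y → ℝ)).Nonempty)
    (h : A.Informative) : 0 < infoCapacity A := by
  have h1 : (1 : Y → ℝ) ∈ convexHull ℝ (A : Set (Y → ℝ)) := by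
    rw [h]; trivial
  obtain ⟨ι, _, w, z, hw0, hw1, hz, hwz⟩ := mem_convexHull_iff_exists_fintype.1 h1
  set M := 1 + ∑ i, ∑ y, |z i y| with hM
  have hM1 : 1 ≤ M := le_add_of_nonneg_right (sum_nonneg fun i _ => sum_nonneg fun y _ =>
    abs_nonneg _)
  have hzM : ∀ i y, |z i y| ≤ M := by
    intro i y
    have h2 : |z i y| ≤ ∑ y, |z i y| :=
      single_le_sum (f := fun y => |z i y|) (fun y _ => abs_nonneg _) (mem_univ y)
    have h3 : ∑ y, |z i y| ≤ ∑ i, ∑ y, |z i y| :=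
      single_le_sum (f := fun i => ∑ y, |z i y|) (fun i _ => sum_nonneg fun y _ => abs_nonneg _)
        (mem_univ i)
    linarith
  -- scale the combination by `e = 1 / (2 * M ^ 2)`
  set e := 1 / (2 * M ^ 2) with he
  have he0 : 0 < e := by positivity
  have heM : e * M ^ 2 = 1 / 2 := by
    rw [he]; field_simp
  have hexp : ∀ i y, exp (-(e * z i y)) ≤ 1 - e * z i y + e / 2 := by
    intro i y
    have h2 : (z i y) ^ 2 ≤ M ^ 2 := sq_le_sq' (abs_le.1 (hzM i y)).1 (abs_le.1 (hzM i y)).2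
    have h3 : |e * z i y| ≤ 1 := by
      rw [abs_mul, abs_of_pos he0]
      have h4 := mul_le_mul_of_nonneg_left (hzM i y) he0.le
      have h5 := mul_le_mul_of_nonneg_left (show M ≤ M ^ 2 by nlinarith) he0.le
      linarith
    have h6 := exp_neg_le_of_abs_le_one h3
    have h7 : (e * z i y) ^ 2 ≤ e / 2 := by
      have h8 := mul_le_mul_of_nonneg_left h2 (sq_nonneg e)
      have h9 : e ^ 2 * M ^ 2 = e * (e * M ^ 2) := by ring
      rw [h9, heM] at h8
      have h10 : (e * z i y) ^ 2 = e ^ 2 * z i y ^ 2 := by ring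
      linarith
    linarith
  have hmix : ∀ y, ∑ i, w i * exp (-(e * z i y)) ≤ 1 - e / 2 := by
    intro y
    have h2 : ∑ i, w i * z i y = 1 := by
      have := congrFun hwz y
      simpa [Finset.sum_apply] using this
    calc ∑ i, w i * exp (-(e * z i y)) ≤ ∑ i, w i * (1 - e * z i y + e / 2) :=
          sum_le_sum fun i _ => mul_le_mul_of_nonneg_left (hexp i y) (hw0 i)
      _ = (1 + e / 2) * ∑ i, w i - e * ∑ i, w i * z i y := by
          rw [mul_sum, mul_sum, ← sum_sub_distrib]
          exact sum_congr rfl fun i _ => by ring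
      _ = 1 - e / 2 := by rw [hw1, h2]; ring
  have he1 : e / 2 < 1 := by
    have : e * 1 ≤ e * M ^ 2 := mul_le_mul_of_nonneg_left (one_le_pow₀ hM1) he0.le
    linarith
  set c := -log (1 - e / 2) / log 2 with hc
  have hlog : log (1 - e / 2) < 0 := log_neg (by linarith) (by linarith)
  have hc0 : 0 < c := div_pos (by linarith) (log_pos one_lt_two)
  have hcexp : exp (-(c * log 2)) = 1 - e / 2 := by
    rw [hc, div_mul_cancel₀ _ (log_pos one_lt_two).ne', neg_neg, exp_log (by linarith)]
  refine lt_of_lt_of_le (EReal.coe_pos.2 hc0) (le_infoCapacity hA fun q => ?_)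
  by_contra! hcon
  rw [hcexp] at hcon
  have h2 : ∑ i, w i * expMoment ⇑q (e • z i) = ∑ y, (q : Y → ℝ) y * ∑ i, w i * exp (-(e * z i y)) := by
    simp only [expMoment, mul_sum, Pi.smul_apply, smul_eq_mul]
    rw [sum_comm]
    exact sum_congr rfl fun y _ => sum_congr rfl fun i _ => by ring
  have h3 : ∑ y, (q : Y → ℝ) y * ∑ i, w i * exp (-(e * z i y)) ≤ 1 - e / 2 := by
    calc _ ≤ ∑ y, (q : Y → ℝ) y * (1 - e / 2) :=
          sum_le_sum fun y _ => mul_le_mul_of_nonneg_left (hmix y) (stdSimplex.zero_le q y)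
      _ = 1 - e / 2 := by rw [← sum_mul, stdSimplex.sum_eq_one, one_mul]
  have h4 : ∑ i, w i * (1 - e / 2) < ∑ i, w i * expMoment ⇑q (e • z i) := by
    have hne : ∃ i, w i ≠ 0 := by
      by_contra! h0
      simp [h0] at hw1
    obtain ⟨i, hi⟩ := hne
    exact sum_lt_sum
      (fun i _ => mul_le_mul_of_nonneg_left (hcon _ (DCCone.smul_mem' he0.le (hz i))).le (hw0 i))
      ⟨i, mem_univ i, mul_lt_mul_of_pos_left (hcon _ (DCCone.smul_mem' he0.le (hz i)))
        ((hw0 i).lt_of_ne' hi)⟩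
  rw [← sum_mul, hw1, one_mul] at h4
  linarith

theorem infoCapacity_eq_zero_iff (hA : (A : Set (Y → ℝ)).Nonempty) :
    infoCapacity A = 0 ↔ ¬ A.Informative :=
  ⟨fun h0 h => (infoCapacity_pos_of_informative hA h).ne' h0,
    infoCapacity_eq_zero_of_not_informative hA⟩

end Capacity

/-! ### Monotonicity and additivity. -/

section Comparison

variable {Y : Type u} {Z : Type v} [Fintype Y] [Fintype Z]

theorem infoCapacity_mono {A B : DCCone Y} (hA : (A : Set (Y → ℝ)).Nonempty)
    (h : ∀ a ∈ A, a ∈ B) : infoCapacity A ≤ infoCapacity B := by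
  have hB : (B : Set (Y → ℝ)).Nonempty := hA.imp h
  rw [infoCapacity_of_nonempty hA, infoCapacity_of_nonempty hB]
  exact iInf_mono fun q => biSup_mono h

theorem infoCapacity_le_of_nondetDegraded {A : DCCone Y} {B : DCCone Z}
    (hA : (A : Set (Y → ℝ)).Nonempty) (hB : (B : Set (Z → ℝ)).Nonempty)
    (h : B.NondetDegraded A) : infoCapacity B ≤ infoCapacity A := by
  obtain ⟨F, hF, hBF⟩ := h
  have hFne : ∀ y, (F y : Set (Z → ℝ)).Nonempty := by
    intro y
    obtain ⟨b, hb⟩ := hB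
    obtain ⟨a, _, f, hf, _⟩ := hBF hb
    exact ⟨f y, hf y⟩
  choose r hr using fun y => DCCone.exists_forall_mean_nonpos (hFne y) (hF y)
  refine EReal.ge_of_forall_gt_iff_ge.1 fun c hc => le_infoCapacity hA fun q => ?_
  -- Push `q` through the kernel `r`. The moment of `b = a + f` under `q'` averages `exp (-a y)`
  -- times the moment of `f y` under `r y`, which is at least 1, so `a` does at least as well under
  -- `q`.
  let q' : stdSimplex ℝ Z := ⟨fun z => ∑ y, (q : Y → ℝ) y * (r y : Z → ℝ) z,
    fun z => sum_nonneg fun y _ => mul_nonneg (stdSimplex.zero_le q y) (stdSimplex.zero_le (r y) z), by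
      rw [sum_comm]
      simp_rw [← mul_sum]
      simp⟩
  have hq' : ∀ z, (q' : Z → ℝ) z = ∑ y, (q : Y → ℝ) y * (r y : Z → ℝ) z := fun z => rfl
  obtain ⟨b, hb, hlt⟩ := exists_expMoment_lt hB hc q'
  obtain ⟨a, ha, f, hf, hbf⟩ := hBF hb
  refine ⟨a, ha, le_trans ?_ hlt.le⟩
  have hbf' : ∀ y z, b z = a y + f y z := fun y z => congrFun hbf (y, z)
  have h1 : expMoment ⇑q' b = ∑ y, (q : Y → ℝ) y * exp (-a y) * expMoment ⇑(r y) (f y) := by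
    simp only [expMoment, hq', sum_mul, mul_sum]
    rw [sum_comm]
    refine sum_congr rfl fun y _ => sum_congr rfl fun z _ => ?_
    rw [hbf' y z, neg_add, exp_add]
    ring
  rw [h1, expMoment]
  refine sum_le_sum fun y _ => le_mul_of_one_le_right
    (mul_nonneg (stdSimplex.zero_le q y) (exp_pos _).le) ?_
  have := one_sub_le_expMoment (r y) (f y)
  have := hr y (f y) (hf y)
  linarith

theorem add_le_infoCapacity_prod {A : DCCone Y} {B : DCCone Z}
    (hA : (A : Set (Y → ℝ)).Nonempty) (hB : (B : Set (Z → ℝ)).Nonempty) :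
    infoCapacity A + infoCapacity B ≤ infoCapacity (A.prod B) := by
  have hreal : ∀ c d : ℝ, (c : EReal) < infoCapacity A → (d : EReal) < infoCapacity B →
      ((c + d : ℝ) : EReal) ≤ infoCapacity (A.prod B) := by
    intro c d hc hd
    refine le_infoCapacity (DCCone.prod_nonempty hA hB) fun q => ?_
    let q₁ : stdSimplex ℝ Y := ⟨fun y => ∑ z, (q : Y × Z → ℝ) (y, z),
      fun y => sum_nonneg fun z _ => stdSimplex.zero_le q _, by
        rw [← Fintype.sum_prod_type]; exact stdSimplex.sum_eq_one q⟩
    have hq₁ : ∀ y, (q₁ : Y → ℝ) y = ∑ z, (q : Y × Z → ℝ) (y, z) := fun y => rfl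
    obtain ⟨a, ha, hac⟩ := exists_expMoment_lt hA hc q₁
    have hpos := expMoment_pos q₁ a
    have ht : ∑ z, ∑ y, (q : Y × Z → ℝ) (y, z) * exp (-a y) = expMoment ⇑q₁ a := by
      rw [sum_comm]
      simp only [expMoment, hq₁, sum_mul]
    -- `q₂` is the second marginal of the joint law reweighted by `exp (-a)`, which makes the moment
    -- of `a + b` factor exactly even when `q` is not a product.
    obtain ⟨q₂, hq₂⟩ := exists_stdSimplex_reweight
      (fun z => ∑ y, (q : Y × Z → ℝ) (y, z) * exp (-a y)) (fun _ => 1)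
      (fun z => sum_nonneg fun y _ => mul_nonneg (stdSimplex.zero_le q _) (exp_pos _).le)
      (fun _ => zero_le_one) (by simpa only [mul_one, ht] using hpos)
    simp only [mul_one, ht] at hq₂
    obtain ⟨b, hb, hbd⟩ := exists_expMoment_lt hB hd q₂
    refine ⟨_, ⟨a, ha, b, hb, 0, le_rfl, rfl⟩, ?_⟩
    have h1 : expMoment ⇑q (fun yz => a yz.1 + b yz.2 + (0 : Y × Z → ℝ) yz) =
        expMoment ⇑q₁ a * expMoment ⇑q₂ b := by
      have h2 : expMoment ⇑q₂ b =
          (∑ z, (∑ y, (q : Y × Z → ℝ) (y, z) * exp (-a y)) * exp (-b z)) / expMoment ⇑q₁ a := by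
        conv_lhs => rw [expMoment]
        rw [sum_div]
        exact sum_congr rfl fun z _ => by rw [hq₂]; ring
      rw [h2, mul_div_cancel₀ _ hpos.ne', expMoment, Fintype.sum_prod_type, sum_comm]
      refine sum_congr rfl fun z _ => ?_
      rw [sum_mul]
      refine sum_congr rfl fun y _ => ?_
      simp only [Pi.zero_apply, add_zero, neg_add, exp_add]
      ring
    rw [h1, add_mul, neg_add, exp_add]
    exact mul_le_mul hac.le hbd.le (expMoment_pos q₂ b).le (exp_pos _).le
  refine EReal.add_le_of_forall_lt fun c' hc' d' hd' => ?_
  obtain ⟨c, hc1, hc2⟩ := EReal.lt_iff_exists_real_btwn.1 hc'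
  obtain ⟨d, hd1, hd2⟩ := EReal.lt_iff_exists_real_btwn.1 hd'
  refine (add_le_add hc1.le hd1.le).trans ?_
  rw [← EReal.coe_add]
  exact hreal c d hc2 hd2

/-- Use a product `q`: the bound on the second factor holds for each `y` separately, so letting the
second portfolio depend on `y` gains nothing. -/
theorem infoCapacity_semidirectConst_le {A : DCCone Y} {B : DCCone Z}
    (hA : (A : Set (Y → ℝ)).Nonempty) (hB : (B : Set (Z → ℝ)).Nonempty) :
    infoCapacity (A.semidirectConst B) ≤ infoCapacity A + infoCapacity B := by
  have hreal : ∀ c d : ℝ, infoCapacity A < c → infoCapacity B < d →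
      infoCapacity (A.semidirectConst B) ≤ ((c + d : ℝ) : EReal) := by
    intro c d hc hd
    obtain ⟨q₁, hq₁⟩ := exists_forall_lt_expMoment hA hc
    obtain ⟨q₂, hq₂⟩ := exists_forall_lt_expMoment hB hd
    let q : stdSimplex ℝ (Y × Z) := ⟨fun yz => (q₁ : Y → ℝ) yz.1 * (q₂ : Z → ℝ) yz.2,
      fun yz => mul_nonneg (stdSimplex.zero_le q₁ _) (stdSimplex.zero_le q₂ _), by
        rw [Fintype.sum_prod_type]
        simp_rw [← mul_sum]
        simp⟩
    have hq : ∀ yz, (q : Y × Z → ℝ) yz = (q₁ : Y → ℝ) yz.1 * (q₂ : Z → ℝ) yz.2 := fun _ => rfl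
    refine infoCapacity_le ((DCCone.prod_nonempty hA hB).imp DCCone.prod_le_semidirectConst)
      ⟨q, fun s hs => ?_⟩
    obtain ⟨a, ha, f, hf, rfl⟩ := hs
    have h1 : expMoment ⇑q (fun yz => a yz.1 + f yz.1 yz.2) =
        ∑ y, (q₁ : Y → ℝ) y * exp (-a y) * expMoment ⇑q₂ (f y) := by
      rw [expMoment, Fintype.sum_prod_type]
      refine sum_congr rfl fun y _ => ?_
      rw [expMoment, mul_sum]
      refine sum_congr rfl fun z _ => ?_
      rw [hq, neg_add, exp_add]
      ring
    rw [h1, add_mul, neg_add, exp_add]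
    calc exp (-(c * log 2)) * exp (-(d * log 2)) ≤ expMoment ⇑q₁ a * exp (-(d * log 2)) :=
          mul_le_mul_of_nonneg_right (hq₁ a ha).le (exp_pos _).le
      _ ≤ _ := by
          rw [expMoment, sum_mul]
          exact sum_le_sum fun y _ => mul_le_mul_of_nonneg_left (hq₂ _ (hf y)).le
            (mul_nonneg (stdSimplex.zero_le q₁ y) (exp_pos _).le)
  -- Excludes the indeterminate sum `⊥ + ⊤`.
  have hA0 : infoCapacity A ≠ ⊥ := ((EReal.bot_lt_zero).trans_le (infoCapacity_nonneg hA)).ne'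
  have hB0 : infoCapacity B ≠ ⊥ := ((EReal.bot_lt_zero).trans_le (infoCapacity_nonneg hB)).ne'
  refine EReal.le_add_of_forall_gt (.inl hA0) (.inr hB0) fun c' hc' d' hd' => ?_
  obtain ⟨c, hc1, hc2⟩ := EReal.lt_iff_exists_real_btwn.1 hc'
  obtain ⟨d, hd1, hd2⟩ := EReal.lt_iff_exists_real_btwn.1 hd'
  refine le_trans ?_ (add_le_add hc2.le hd2.le)
  rw [← EReal.coe_add]
  exact hreal c d hc1 hd1

end Comparison

/-! ### Mutual information and its variational bounds. -/

section MutualInfo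

variable {T : Type v} {Y : Type u} [Fintype Y]

/-- The output distribution of a channel `W` with input distribution `p`. -/
noncomputable def outputDist (p : Convexity.StdSimplex ℝ T) (W : T → stdSimplex ℝ Y) (y : Y) : ℝ :=
  ∑ s ∈ p.weights.support, p.weights s * (W s : Y → ℝ) y

theorem outputDist_mem (p : Convexity.StdSimplex ℝ T) (W : T → stdSimplex ℝ Y) :
    outputDist p W ∈ stdSimplex ℝ Y := by
  refine ⟨fun y => sum_nonneg fun t _ => mul_nonneg (p.weights_nonneg t) (stdSimplex.zero_le _ _), ?_⟩
  simp only [outputDist]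
  rw [sum_comm]
  simp_rw [← mul_sum, stdSimplex.sum_eq_one, mul_one]
  exact p.total

theorem eq_zero_of_outputDist_eq_zero {p : Convexity.StdSimplex ℝ T} {W : T → stdSimplex ℝ Y}
    {y : Y} (h : outputDist p W y = 0) {t : T} (ht : t ∈ p.weights.support) :
    (W t : Y → ℝ) y = 0 :=
  (mul_eq_zero.1 ((sum_eq_zero_iff_of_nonneg fun t _ =>
    mul_nonneg (p.weights_nonneg t) (stdSimplex.zero_le (W t) y)).1 h t ht)).resolve_left
    (Finsupp.mem_support_iff.1 ht)

theorem mutualInfo_eq (p : Convexity.StdSimplex ℝ T) (W : T → stdSimplex ℝ Y) :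
    mutualInfo p W =
      (∑ t ∈ p.weights.support, p.weights t * relEntropy ⇑(W t) (outputDist p W)) / log 2 := by
  rw [mutualInfo, sum_div]
  refine sum_congr rfl fun t _ => ?_
  rw [relEntropy, mul_sum, sum_div]
  refine sum_congr rfl fun y _ => ?_
  rw [logb, outputDist]
  ring

/-- Replacing the output distribution by another one increases the average relative entropy. -/
theorem sum_relEntropy_outputDist_le (p : Convexity.StdSimplex ℝ T) (W : T → stdSimplex ℝ Y)
    (q : stdSimplex ℝ Y)
    (hq : ∀ t ∈ p.weights.support, ∀ y, (W t : Y → ℝ) y ≠ 0 → (q : Y → ℝ) y ≠ 0) :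
    ∑ t ∈ p.weights.support, p.weights t * relEntropy ⇑(W t) (outputDist p W) ≤
      ∑ t ∈ p.weights.support, p.weights t * relEntropy ⇑(W t) ⇑q := by
  let o : stdSimplex ℝ Y := ⟨outputDist p W, outputDist_mem p W⟩
  have ho : ⇑o = outputDist p W := rfl
  have h1 := relEntropy_nonneg o q fun y hy => by
    obtain ⟨t, ht, hty⟩ := exists_ne_zero_of_sum_ne_zero hy
    exact hq t ht y (right_ne_zero_of_mul hty)
  -- Compensation identity: the excess is the relative entropy of the output law to `q`.
  have h2 : ∑ t ∈ p.weights.support, p.weights t * relEntropy ⇑(W t) ⇑q =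
      ∑ t ∈ p.weights.support, p.weights t * relEntropy ⇑(W t) (outputDist p W) +
        relEntropy ⇑o ⇑q := by
    have h3 : relEntropy ⇑o ⇑q = ∑ t ∈ p.weights.support, p.weights t *
        ∑ y, (W t : Y → ℝ) y * log (outputDist p W y / (q : Y → ℝ) y) := by
      simp_rw [mul_sum]
      rw [sum_comm, relEntropy, ho]
      refine sum_congr rfl fun y _ => ?_
      conv_lhs => rw [outputDist, sum_mul]
      refine sum_congr rfl fun t _ => ?_
      rw [← outputDist]
      ring
    rw [h3, ← sum_add_distrib]
    refine sum_congr rfl fun t ht => ?_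
    rw [← mul_add, relEntropy, relEntropy, ← sum_add_distrib]
    congr 1
    refine sum_congr rfl fun y _ => ?_
    by_cases hy : (W t : Y → ℝ) y = 0
    · simp [hy]
    · have hoy : outputDist p W y ≠ 0 := fun h => hy (eq_zero_of_outputDist_eq_zero h ht)
      have hqy := hq t ht y hy
      rw [log_div hy hqy, log_div hy hoy, log_div hoy hqy]
      ring
  linarith

/-- Log-sum inequality for the joint law against the product of its marginals weighted by `exp
(-f)`. That measure has mass at most `r`, since `hr` bounds the average over `t` for each `y`. -/
theorem neg_log_le_sum_relEntropy (p : Convexity.StdSimplex ℝ T) (W : T → stdSimplex ℝ Y)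
    (f : T → Y → ℝ) (hW : ∀ t, ∑ y, (W t : Y → ℝ) y * f t y ≤ 0) {r : ℝ}
    (hr : ∀ y, ∑ t ∈ p.weights.support, p.weights t * exp (-f t y) ≤ r) :
    -log r ≤
      ∑ t ∈ p.weights.support, p.weights t * relEntropy ⇑(W t) (outputDist p W) := by
  have ho := outputDist_mem p W
  have h := neg_log_sum_le (p.weights.support ×ˢ (univ : Finset Y))
    (fun i => p.weights i.1 * (W i.1 : Y → ℝ) i.2)
    (fun i => p.weights i.1 * outputDist p W i.2 * exp (-f i.1 i.2))
    (fun i _ => mul_nonneg (p.weights_nonneg _) (stdSimplex.zero_le _ _))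
    (fun i _ => mul_nonneg (mul_nonneg (p.weights_nonneg _) (ho.1 _)) (exp_pos _).le)
    (fun i hi h0 => by
      have hi1 := (mem_product.1 hi).1
      have h1 := (mul_eq_zero.1 h0).resolve_right (exp_pos _).ne'
      rw [eq_zero_of_outputDist_eq_zero
        ((mul_eq_zero.1 h1).resolve_left (Finsupp.mem_support_iff.1 hi1)) hi1, mul_zero])
    (by
      rw [sum_product]
      simp_rw [← mul_sum, stdSimplex.sum_eq_one, mul_one]
      exact p.total)
  rw [sum_product, sum_product] at h
  have h1 : ∑ t ∈ p.weights.support, ∑ y, p.weights t * outputDist p W y * exp (-f t y) ≤ r := by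
    rw [sum_comm]
    calc _ = ∑ y, outputDist p W y * ∑ t ∈ p.weights.support, p.weights t * exp (-f t y) := by
          refine sum_congr rfl fun y _ => ?_
          rw [mul_sum]
          exact sum_congr rfl fun t _ => by ring
      _ ≤ ∑ y, outputDist p W y * r := sum_le_sum fun y _ => mul_le_mul_of_nonneg_left (hr y) (ho.1 y)
      _ = r := by rw [← sum_mul, ho.2, one_mul]
  have hpos : 0 < ∑ t ∈ p.weights.support, ∑ y, p.weights t * outputDist p W y * exp (-f t y) := by
    obtain ⟨t, ht⟩ := p.support_weights_nonempty
    obtain ⟨y, -, hy⟩ : ∃ y ∈ univ, outputDist p W y ≠ 0 :=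
      exists_ne_zero_of_sum_ne_zero (by rw [ho.2]; exact one_ne_zero)
    have hnn : ∀ t y, 0 ≤ p.weights t * outputDist p W y * exp (-f t y) := fun t y =>
      mul_nonneg (mul_nonneg (p.weights_nonneg _) (ho.1 _)) (exp_pos _).le
    refine sum_pos' (fun t _ => sum_nonneg fun y _ => hnn t y) ⟨t, ht, sum_pos' (fun y _ => hnn t y)
      ⟨y, mem_univ y, mul_pos (mul_pos ?_ ?_) (exp_pos _)⟩⟩
    · exact (p.weights_nonneg t).lt_of_ne' (Finsupp.mem_support_iff.1 ht)
    · exact (ho.1 y).lt_of_ne' hy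
  have h2 : ∑ t ∈ p.weights.support, ∑ y, p.weights t * (W t : Y → ℝ) y *
      log (p.weights t * (W t : Y → ℝ) y / (p.weights t * outputDist p W y * exp (-f t y))) =
      ∑ t ∈ p.weights.support, p.weights t * (relEntropy ⇑(W t) (outputDist p W) +
        ∑ y, (W t : Y → ℝ) y * f t y) := by
    refine sum_congr rfl fun t ht => ?_
    rw [relEntropy, ← sum_add_distrib, mul_sum]
    refine sum_congr rfl fun y _ => ?_
    by_cases hy : (W t : Y → ℝ) y = 0
    · simp [hy]
    · have hoy : outputDist p W y ≠ 0 := fun h => hy (eq_zero_of_outputDist_eq_zero h ht)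
      rw [mul_assoc (p.weights t), mul_assoc (p.weights t),
        mul_div_mul_left _ _ (Finsupp.mem_support_iff.1 ht),
        log_div hy (mul_ne_zero hoy (exp_pos _).ne'), log_mul hoy (exp_pos _).ne', log_exp,
        log_div hy hoy]
      ring
  have h3 : ∑ t ∈ p.weights.support, p.weights t * (relEntropy ⇑(W t) (outputDist p W) +
        ∑ y, (W t : Y → ℝ) y * f t y) ≤
      ∑ t ∈ p.weights.support, p.weights t * relEntropy ⇑(W t) (outputDist p W) :=
    sum_le_sum fun t _ => mul_le_mul_of_nonneg_left (by linarith [hW t]) (p.weights_nonneg t)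
  have h4 := log_le_log hpos h1
  rw [h2] at h
  linarith

theorem sum_weights_map {X : Type w} (p : Convexity.StdSimplex ℝ T) (f : T → X) (g : X → ℝ) :
    ∑ x ∈ (p.map f).weights.support, (p.map f).weights x * g x =
      ∑ t ∈ p.weights.support, p.weights t * g (f t) :=
  Finsupp.sum_mapDomain_index (h := fun x r => r * g x) (by simp) (by intros; ring)

theorem mutualInfo_map {X : Type w} (p : Convexity.StdSimplex ℝ T) (f : T → X)
    (W : X → stdSimplex ℝ Y) : mutualInfo (p.map f) W = mutualInfo p (W ∘ f) := by
  have ho : outputDist (p.map f) W = outputDist p (W ∘ f) :=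
    funext fun y => sum_weights_map p f fun x => (W x : Y → ℝ) y
  rw [mutualInfo_eq, mutualInfo_eq, sum_weights_map p f fun x => relEntropy ⇑(W x) _, ho]
  rfl

theorem mutualInfo_le_of_relEntropy_le (p : Convexity.StdSimplex ℝ T) (W : T → stdSimplex ℝ Y)
    (q : stdSimplex ℝ Y) {c : ℝ}
    (hq : ∀ t, (∀ y, (W t : Y → ℝ) y ≠ 0 → (q : Y → ℝ) y ≠ 0) ∧
      relEntropy ⇑(W t) ⇑q ≤ c * log 2) : mutualInfo p W ≤ c := by
  rw [mutualInfo_eq, div_le_iff₀ (log_pos one_lt_two)]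
  refine (sum_relEntropy_outputDist_le p W q fun t _ => (hq t).1).trans ?_
  calc _ ≤ ∑ t ∈ p.weights.support, p.weights t * (c * log 2) :=
        sum_le_sum fun t _ => mul_le_mul_of_nonneg_left (hq t).2 (p.weights_nonneg t)
    _ = c * log 2 := by
        rw [← sum_mul]
        exact (congrArg (· * (c * log 2)) p.total).trans (one_mul _)

end MutualInfo

/-! ### The mutual information characterization. -/

section Characterization

variable {Y : Type u} [Fintype Y] {A : DCCone Y}

/-- A mixed strategy on `A` guaranteeing any value below the capacity, by the minimax theorem. -/
theorem exists_forall_le_mutualInfo (hA : (A : Set (Y → ℝ)).Nonempty) {c : ℝ}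
    (hc : (c : EReal) < infoCapacity A) :
    ∃ p : Convexity.StdSimplex ℝ A, ∀ W : A → stdSimplex ℝ Y,
      (∀ t : A, ∑ y, (t : Y → ℝ) y * (W t : Y → ℝ) y ≤ 0) → c ≤ mutualInfo p W := by
  -- Convex combinations of the vectors `exp (-a)` are finite mixtures of portfolios; `huc` is then
  -- the pointwise bound required by `neg_log_le_sum_relEntropy`.
  obtain ⟨u, hu, huc⟩ := exists_mem_convexHull_forall_lt
    (S := Set.range fun (a : A) (y : Y) => exp (-(a : Y → ℝ) y)) (c := exp (-(c * log 2)))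
    (by
      obtain ⟨a, ha⟩ := hA
      exact ⟨_, ⟨a, ha⟩, rfl⟩)
    (fun q => by
      obtain ⟨a, ha, h⟩ := exists_expMoment_lt hA hc q
      exact ⟨_, ⟨⟨a, ha⟩, rfl⟩, h⟩)
  obtain ⟨ι, _, w, z, hw0, hw1, hz, hwz⟩ := mem_convexHull_iff_exists_fintype.1 hu
  choose t ht using hz
  let p₀ : Convexity.StdSimplex ℝ ι :=
    ⟨Finsupp.equivFunOnFinite.symm w, fun i => hw0 i, by
      rw [Finsupp.sum_fintype _ _ fun _ => rfl]
      simpa using hw1⟩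
  have hp₀ : ∀ g : ι → ℝ, ∑ i ∈ p₀.weights.support, p₀.weights i * g i = ∑ i, w i * g i := by
    intro g
    exact Finsupp.sum_fintype p₀.weights (fun i r => r * g i) (by simp)
  refine ⟨p₀.map t, fun W hW => ?_⟩
  have h := neg_log_le_sum_relEntropy (p₀.map t) W (fun a => (a : Y → ℝ))
    (fun a => by simpa only [mul_comm] using hW a) (r := exp (-(c * log 2))) fun y => by
      rw [sum_weights_map p₀ t fun a => exp (-(a : Y → ℝ) y), hp₀]
      refine le_trans (le_of_eq ?_) (huc y).le
      have h1 := congrFun hwz y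
      rw [Finset.sum_apply] at h1
      rw [← h1]
      exact sum_congr rfl fun i _ => by rw [← ht i]; rfl
  rw [log_exp, neg_neg] at h
  rw [mutualInfo_eq]
  exact (le_div_iff₀ (log_pos one_lt_two)).2 h

theorem infoCapacity_eq_iSup_mutualInfo (hA : (A : Set (Y → ℝ)).Nonempty) :
    infoCapacity A = ⨆ p : Convexity.StdSimplex ℝ A,
      ⨅ (W : A → stdSimplex ℝ Y)
        (_ : ∀ t : A, ∑ y, (t : Y → ℝ) y * (W t : Y → ℝ) y ≤ 0),
        (mutualInfo p W : EReal) := by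
  refine le_antisymm (EReal.ge_of_forall_gt_iff_ge.1 fun c hc => ?_)
    (iSup_le fun p => EReal.le_of_forall_lt_iff_le.1 fun c hc => ?_)
  · obtain ⟨p, hp⟩ := exists_forall_le_mutualInfo hA hc
    exact le_iSup_of_le p (le_iInf₂ fun W hW => EReal.coe_le_coe_iff.2 (hp W hW))
  -- One near-optimal `q` serves all portfolios: each `W t` is feasible for `t` with divergence at
  -- most `c` bits from that `q`, which bounds the mutual information for any `p`.
  · obtain ⟨q, hq⟩ := exists_forall_lt_expMoment hA hc
    choose W hW hWq using fun t : A => exists_relEntropy_le q t (c * log 2)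
      fun l hl => (hq _ (DCCone.smul_mem' hl t.2)).le
    exact iInf₂_le_of_le W (fun t => by simpa only [mul_comm] using hW t)
      (EReal.coe_le_coe_iff.2 (mutualInfo_le_of_relEntropy_le p W q hWq))

end Characterization

/-! ### Unions of halfspaces and Shannon capacity. -/

section Shannon

variable {Y : Type u} [Fintype Y]

theorem support_of_forall_expMoment {p q : stdSimplex ℝ Y} {c : ℝ}
    (h : ∀ a : Y → ℝ, ∑ y, (p : Y → ℝ) y * a y ≤ 0 → exp (-c) ≤ expMoment ⇑q a) (y : Y)
    (hp : (p : Y → ℝ) y ≠ 0) : (q : Y → ℝ) y ≠ 0 := by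
  classical
  intro hq
  -- A mean-zero portfolio under `p` equal to `c + 1` off `y`. If `q` ignored `y`, its moment would
  -- be `exp (-(c + 1))`, too small.
  have h1 := h (fun z => (c + 1) - if z = y then (c + 1) / (p : Y → ℝ) y else 0) (by
    simp_rw [mul_sub, sum_sub_distrib, ← sum_mul, mul_ite, mul_zero]
    rw [sum_ite_eq' univ y, if_pos (mem_univ y), stdSimplex.sum_eq_one, mul_div_cancel₀ _ hp]
    simp)
  have h2 : expMoment ⇑q (fun z => (c + 1) - if z = y then (c + 1) / (p : Y → ℝ) y else 0) =
      exp (-(c + 1)) := by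
    calc _ = ∑ z, (q : Y → ℝ) z * exp (-(c + 1)) := by
          refine sum_congr rfl fun z _ => ?_
          by_cases hz : z = y
          · rw [hz, hq, zero_mul, zero_mul]
          · simp only [if_neg hz, sub_zero]
      _ = _ := by rw [← sum_mul, stdSimplex.sum_eq_one, one_mul]
  rw [h2, exp_le_exp] at h1
  linarith

/-- The halfspace of `p` determines the relative entropy with respect to `p`. -/
theorem relEntropy_le_of_forall_expMoment {p q : stdSimplex ℝ Y} {c : ℝ}
    (h : ∀ a : Y → ℝ, ∑ y, (p : Y → ℝ) y * a y ≤ 0 → exp (-c) ≤ expMoment ⇑q a) :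
    relEntropy ⇑p ⇑q ≤ c := by
  classical
  have hpq := support_of_forall_expMoment h
  suffices hexp : exp (-c) ≤ exp (-relEntropy ⇑p ⇑q) by
    have := exp_le_exp.1 hexp
    linarith
  refine le_of_forall_pos_le_add fun e he => ?_
  set D := relEntropy ⇑p ⇑q with hD
  -- Equality case of the duality: on the support of `p`, `q * exp (-a) = p * exp (-D)`. Off it, `a`
  -- is free, and `-log e` makes the contribution at most `e`.
  let a : Y → ℝ := fun y => if (p : Y → ℝ) y = 0 then -log e else
    D - log ((p : Y → ℝ) y / (q : Y → ℝ) y)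
  have hmean : ∑ y, (p : Y → ℝ) y * a y = 0 := by
    calc ∑ y, (p : Y → ℝ) y * a y = ∑ y, ((p : Y → ℝ) y * D -
          (p : Y → ℝ) y * log ((p : Y → ℝ) y / (q : Y → ℝ) y)) := by
          refine sum_congr rfl fun y _ => ?_
          by_cases hy : (p : Y → ℝ) y = 0
          · simp [hy]
          · simp only [a, if_neg hy]; ring
      _ = 0 := by
          rw [sum_sub_distrib, ← sum_mul, stdSimplex.sum_eq_one, one_mul, hD, relEntropy, sub_self]
  refine (h a hmean.le).trans ?_
  calc expMoment ⇑q a ≤ ∑ y, ((p : Y → ℝ) y * exp (-D) + (q : Y → ℝ) y * e) := by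
        refine sum_le_sum fun y _ => ?_
        by_cases hy : (p : Y → ℝ) y = 0
        · simp only [a, if_pos hy, neg_neg, exp_log he, hy, zero_mul, zero_add, le_refl]
        · have hp0 : 0 < (p : Y → ℝ) y := (stdSimplex.zero_le p y).lt_of_ne' hy
          have hq0 : 0 < (q : Y → ℝ) y := (stdSimplex.zero_le q y).lt_of_ne' (hpq y hy)
          have h1 : (q : Y → ℝ) y * exp (-a y) = (p : Y → ℝ) y * exp (-D) := by
            simp only [a, if_neg hy]
            rw [neg_sub, sub_eq_add_neg, exp_add, exp_log (div_pos hp0 hq0), ← mul_assoc,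
              mul_div_cancel₀ _ hq0.ne']
          rw [h1]
          exact le_add_of_nonneg_right (mul_nonneg hq0.le he.le)
    _ = _ := by
        rw [sum_add_distrib, ← sum_mul, ← sum_mul, stdSimplex.sum_eq_one, stdSimplex.sum_eq_one,
          one_mul, one_mul]

theorem exists_forall_mutualInfo_le {X : Type w} [Finite X] [Nonempty X]
    (W : X → stdSimplex ℝ Y) :
    ∃ p : Convexity.StdSimplex ℝ X, ∀ p' : Convexity.StdSimplex ℝ X,
      mutualInfo p' W ≤ mutualInfo p W := by
  classical
  cases nonempty_fintype X
  -- The difference-of-entropies form is continuous on the whole simplex because `x * log x` is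
  -- continuous at 0; compactness then gives a maximiser.
  let I : (X → ℝ) → ℝ := fun p =>
    (∑ x, ∑ y, p x * ((W x : Y → ℝ) y * log ((W x : Y → ℝ) y)) -
      ∑ y, (∑ x, p x * (W x : Y → ℝ) y) * log (∑ x, p x * (W x : Y → ℝ) y)) / log 2
  have hI : Continuous I := by
    refine Continuous.div_const (Continuous.sub (by fun_prop) ?_) _
    exact continuous_finsetSum _ fun y _ => continuous_mul_log.comp (by fun_prop)
  have hmem : ∀ p : Convexity.StdSimplex ℝ X, (fun x => p.weights x) ∈ stdSimplex ℝ X := fun p =>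
    ⟨fun x => p.weights_nonneg x, by
      rw [← p.total, Finsupp.sum_fintype _ _ fun _ => rfl]⟩
  have hIp : ∀ p : Convexity.StdSimplex ℝ X, mutualInfo p W = I fun x => p.weights x := by
    intro p
    have hsum : ∀ g : X → ℝ, ∑ x, p.weights x * g x =
        ∑ x ∈ p.weights.support, p.weights x * g x := fun g =>
      (Finsupp.sum_fintype p.weights (fun x r => r * g x) (by simp)).symm
    have hout : ∀ y, ∑ x, p.weights x * (W x : Y → ℝ) y = outputDist p W y := fun y => hsum _
    rw [mutualInfo_eq]
    simp only [I, hout]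
    congr 1
    have h1 : ∑ y, outputDist p W y * log (outputDist p W y) =
        ∑ x ∈ p.weights.support, p.weights x *
          ∑ y, (W x : Y → ℝ) y * log (outputDist p W y) := by
      simp_rw [mul_sum]
      rw [sum_comm]
      refine sum_congr rfl fun y _ => ?_
      conv_lhs => enter [1]; rw [outputDist]
      rw [sum_mul]
      exact sum_congr rfl fun x _ => by ring
    simp_rw [← mul_sum]
    rw [hsum, h1, ← sum_sub_distrib]
    refine sum_congr rfl fun x hx => ?_
    rw [← mul_sub, relEntropy, ← sum_sub_distrib]
    congr 1
    refine sum_congr rfl fun y _ => ?_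
    by_cases hy : (W x : Y → ℝ) y = 0
    · simp [hy]
    · rw [log_div hy fun h => hy (eq_zero_of_outputDist_eq_zero h hx)]
      ring
  obtain ⟨p, hp, hmax⟩ := (isCompact_stdSimplex ℝ X).exists_isMaxOn
    ⟨_, hmem (Convexity.StdSimplex.single (Classical.arbitrary X))⟩ hI.continuousOn
  refine ⟨⟨Finsupp.equivFunOnFinite.symm p, fun x => hp.1 x, ?_⟩, fun p' => ?_⟩
  · rw [Finsupp.sum_fintype _ _ fun _ => rfl]
    exact hp.2
  · rw [hIp, hIp]
    exact hmax (hmem p')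

theorem isGreatest_mutualInfo_of_eq_iUnion_halfspace {A : DCCone Y}
    (hA : (A : Set (Y → ℝ)).Nonempty) {X : Type w} [Finite X] (W : X → stdSimplex ℝ Y)
    (hAW : A = DCCone.iUnion fun x => DCCone.halfspace (W x)) :
    IsGreatest (Set.range fun p : Convexity.StdSimplex ℝ X => (mutualInfo p W : EReal))
      (infoCapacity A) := by
  have hmem : ∀ a, a ∈ A ↔ ∃ x, ∑ y, (W x : Y → ℝ) y * a y ≤ 0 := by
    intro a
    rw [hAW]
    exact Set.mem_iUnion
  have : Nonempty X := by
    obtain ⟨a, ha⟩ := hA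
    exact ⟨((hmem a).1 ha).choose⟩
  have hle : ∀ p : Convexity.StdSimplex ℝ X, (mutualInfo p W : EReal) ≤ infoCapacity A := by
    refine fun p => EReal.le_of_forall_lt_iff_le.1 fun c hc => EReal.coe_le_coe_iff.2 ?_
    obtain ⟨q, hq⟩ := exists_forall_lt_expMoment hA hc
    have hq' : ∀ x (a : Y → ℝ), ∑ y, (W x : Y → ℝ) y * a y ≤ 0 →
        exp (-(c * log 2)) ≤ expMoment ⇑q a := fun x a ha => (hq a ((hmem a).2 ⟨x, ha⟩)).le
    exact mutualInfo_le_of_relEntropy_le p W q fun x =>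
      ⟨support_of_forall_expMoment (hq' x), relEntropy_le_of_forall_expMoment (hq' x)⟩
  obtain ⟨p, hp⟩ := exists_forall_mutualInfo_le W
  refine ⟨⟨p, le_antisymm (hle p) (EReal.ge_of_forall_gt_iff_ge.1 fun c hc => ?_)⟩, ?_⟩
  · obtain ⟨r, hr⟩ := exists_forall_le_mutualInfo hA hc
    -- Every portfolio lies in the halfspace of some input `x t`, so `W ∘ x` is admissible against
    -- `r`; pushing `r` forward by `x` gives an input law with the same mutual information.
    choose x hx using fun t : A => (hmem t).1 t.2
    have h1 := hr (W ∘ x) fun t => by simpa only [mul_comm, Function.comp_apply] using hx t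
    rw [← mutualInfo_map] at h1
    exact EReal.coe_le_coe_iff.2 (h1.trans (hp _))
  · rintro _ ⟨p, rfl⟩
    exact hle p

end Shannon

end Auxiliary

theorem mainTheorem2 {Y : Type u} {Z : Type v} [Fintype Y] [Fintype Z]
    (A : DCCone Y) (B : DCCone Z)
    (hA : (A : Set (Y → ℝ)).Nonempty) (hB : (B : Set (Z → ℝ)).Nonempty) :
    (infoCapacity A = 0 ↔ ¬ A.Informative) ∧
    (B.NondetDegraded A → infoCapacity B ≤ infoCapacity A) ∧
    (infoCapacity (A.prod B) = infoCapacity (A.semidirectConst B) ∧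
      infoCapacity (A.semidirectConst B) = infoCapacity A + infoCapacity B) ∧
    (infoCapacity A = ⨆ p : Convexity.StdSimplex ℝ A,
      ⨅ (W : A → stdSimplex ℝ Y)
        (_ : ∀ t : A, ∑ y, (t : Y → ℝ) y * (W t : Y → ℝ) y ≤ 0),
        (mutualInfo p W : EReal)) ∧
    (∀ (X : Type w) [Finite X] (W : X → stdSimplex ℝ Y),
      A = DCCone.iUnion (fun x => DCCone.halfspace (W x)) →
      IsGreatest (Set.range fun p : Convexity.StdSimplex ℝ X => (mutualInfo p W : EReal))
        (infoCapacity A)) :=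
  ⟨infoCapacity_eq_zero_iff hA, infoCapacity_le_of_nondetDegraded hA hB,
    ⟨le_antisymm
        (infoCapacity_mono (DCCone.prod_nonempty hA hB) DCCone.prod_le_semidirectConst)
        ((infoCapacity_semidirectConst_le hA hB).trans (add_le_infoCapacity_prod hA hB)),
      le_antisymm (infoCapacity_semidirectConst_le hA hB)
        ((add_le_infoCapacity_prod hA hB).trans
          (infoCapacity_mono (DCCone.prod_nonempty hA hB) DCCone.prod_le_semidirectConst))⟩,
    infoCapacity_eq_iSup_mutualInfo hA,
    fun _ _ W hW => isGreatest_mutualInfo_of_eq_iUnion_halfspace hA W hW⟩
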